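/- Let $F$ be a field and let $q\in F$ be nonzero and not a root of unity (for instance a generic complex number in $F=\mathbb C$, or the indeterminate in $F=\mathbb C(q)$). Put $[k]=\frac{q^k-q^{-k}}{q-q^{-1}}$, $[n]!=[1][2]\cdots[n]$ and $\begin{bmatrix} m\\ r\end{bmatrix}=\frac{[m]!}{[r]!\,[m-r]!}$ for $0\le r\le m$. For every integer $m\ge 1$ the following identity holds in the field $F(w,z_1,\dots,z_m)$ of rational functions in independent variables $w,z_1,\dots,z_m$: $$\sum_{\sigma\in S_m}\sum_{r=0}^m\sigma.\left(\begin{bmatrix} m\\ r\end{bmatrix}\prod_{k=1}^{r}(w-q^{m-1}z_k)\prod_{k=r+1}^{m}(z_k-q^{m-1}w)\prod_{1\le i<j\le m}\frac{z_i-q^2z_j}{z_i-z_j}\right)=0,$$ where $\sigma\in S_m$ acts on rational functions as the automorphism over $F$ with $\sigma(z_i)=z_{\sigma(i)}$ and $\sigma(w)=w$. -/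

import Mathlib

noncomputable section

namespace SerreIdentity

/-- The symmetric quantum integer `[k] = (q ^ k - q ^ (-k)) / (q - q ^ (-1))`. -/
def qNumber {F : Type*} [Field F] (q : F) (k : ℕ) : F :=
  (q ^ k - (q⁻¹) ^ k) / (q - q⁻¹)

/-- The symmetric quantum factorial `[n]! = [1] [2] ⋯ [n]`. -/
def qFactorial {F : Type*} [Field F] (q : F) (n : ℕ) : F :=
  ∏ k ∈ Finset.Icc 1 n, qNumber q k

/-- The symmetric quantum binomial coefficient `[m]! / ([r]! [m - r]!)`, used for `r ≤ m`. -/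
def qBinomial {F : Type*} [Field F] (q : F) (m r : ℕ) : F :=
  qFactorial q m / (qFactorial q r * qFactorial q (m - r))

/-- The field `F(w, z₁, …, zₘ)` of rational functions in `m + 1` independent variables.
The variable `w` is indexed by `none`, the variables `z` by `some i` with `i : Fin m`. -/
abbrev RatFunc (F : Type*) [Field F] (m : ℕ) : Type _ :=
  FractionRing (MvPolynomial (Option (Fin m)) F)

/-- A scalar, seen as a constant rational function. -/
def scalar {F : Type*} [Field F] (m : ℕ) (c : F) : RatFunc F m :=
  algebraMap (MvPolynomial (Option (Fin m)) F) (RatFunc F m) (MvPolynomial.C c)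

/-- The variable `w`. -/
def wVar (F : Type*) [Field F] (m : ℕ) : RatFunc F m :=
  algebraMap (MvPolynomial (Option (Fin m)) F) (RatFunc F m) (MvPolynomial.X none)

/-- The variables `z₁, …, zₘ`, numbered from zero. -/
def zVar (F : Type*) [Field F] {m : ℕ} (i : Fin m) : RatFunc F m :=
  algebraMap (MvPolynomial (Option (Fin m)) F) (RatFunc F m) (MvPolynomial.X (some i))

/-- The action of a permutation on rational functions: the field automorphism that sends
the variable with index `i` to the one with index `σ i` and fixes `w` and all scalars. -/
def permute {F : Type*} [Field F] {m : ℕ} (σ : Equiv.Perm (Fin m)) :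
    RatFunc F m ≃+* RatFunc F m :=
  IsFractionRing.ringEquivOfRingEquiv
    (MvPolynomial.renameEquiv F (Equiv.optionCongr σ)).toRingEquiv

theorem permute_zVar {F : Type*} [Field F] {m : ℕ} (σ : Equiv.Perm (Fin m)) (i : Fin m) :
    permute σ (zVar F i) = zVar F (σ i) := by
  simp [permute, zVar]

theorem permute_wVar {F : Type*} [Field F] {m : ℕ} (σ : Equiv.Perm (Fin m)) :
    permute σ (wVar F m) = wVar F m := by
  simp [permute, wVar]

theorem permute_scalar {F : Type*} [Field F] {m : ℕ} (σ : Equiv.Perm (Fin m)) (c : F) :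
    permute σ (scalar m c) = scalar m c := by
  simp [permute, scalar]

/-- The rational function
`[m choose r] ∏_{k ≤ r} (w - q^(m-1) z_k) ∏_{k > r} (z_k - q^(m-1) w)
  ∏_{i < j} (z_i - q^2 z_j) / (z_i - z_j)`.
As the indices start from zero here, the condition `k ≤ r` reads `k < r`. -/
def term {F : Type*} [Field F] (q : F) (m r : ℕ) : RatFunc F m :=
  scalar m (qBinomial q m r)
    * (∏ k : Fin m with k.val < r, (wVar F m - scalar m (q ^ (m - 1)) * zVar F k))
    * (∏ k : Fin m with r ≤ k.val, (zVar F k - scalar m (q ^ (m - 1)) * wVar F m))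
    * ∏ p : Fin m × Fin m with p.1 < p.2,
        (zVar F p.1 - scalar m (q ^ 2) * zVar F p.2) / (zVar F p.1 - zVar F p.2)

end SerreIdentity

end

/-! Put `t = q ^ 2` and `c = q ^ (m - 1)`. Symmetrizing inside the first `r` and inside the last `m
- r` positions yields t-factorials (`sum_orderedWeight`, `sum_prod_erase_div`), which are `[r]!` and
`[m - r]!` up to powers of `q` and cancel the denominator of the q-binomial. What is left is a sum
over subsets `I` of the variables. After multiplication by the Vandermonde determinant and a power
of `q`, the term of `I` is a Vandermonde determinant with the rows outside `I` scaled by `t`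
(`det_vandermonde_scale`). By multilinearity (`det_add_vandermonde`) the sum over all `I` is one
determinant, with entries `c(w - c z) z^k + (z - c w)(t z)^k = c w (1 - t^k) z^k + (t^k - c^2)
z^(k+1)` at `z = z_i`. Since `c^2 = t^(m-1)`, its `m` columns lie in the span of `z, …, z^(m-1)`, so
it vanishes (`det_eq_zero_of_scaling`). -/

namespace SerreIdentity

open Finset

/-! ### Splitting off the last entry of a permutation. -/

/-- A permutation of `Fin (n + 1)` amounts to the image of the last element together with
a permutation of `Fin n`. -/
theorem sum_perm_succ {M ι : Type*} [AddCommMonoid M] {n : ℕ} (e : Fin (n + 1) → ι)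
    (F : (Fin (n + 1) → ι) → M) :
    ∑ σ : Equiv.Perm (Fin (n + 1)), F (e ∘ σ) =
      ∑ j : Fin (n + 1), ∑ τ : Equiv.Perm (Fin n),
        F (Fin.snoc (α := fun _ => ι) (e ∘ j.succAbove ∘ τ) (e j)) := by
  let Φ : Fin (n + 1) × Equiv.Perm (Fin n) → Equiv.Perm (Fin (n + 1)) := fun p =>
    (finSuccEquivLast.trans (Equiv.optionCongr p.2)).trans (finSuccEquiv' p.1).symm
  have hlast : ∀ p, Φ p (Fin.last n) = p.1 := fun p => by simp [Φ]
  have hcast : ∀ p k, Φ p (Fin.castSucc k) = p.1.succAbove (p.2 k) := fun p k => by simp [Φ]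
  have hinj : Function.Injective Φ := by
    rintro ⟨j, τ⟩ ⟨j', τ'⟩ h
    obtain rfl : j = j' := by
      have := hlast (j, τ)
      rw [h, hlast] at this
      exact this.symm
    have : τ = τ' := by
      ext k : 1
      have := hcast (j, τ) k
      rw [h, hcast] at this
      exact (Fin.succAbove_right_injective this).symm
    rw [this]
  have hbij : Function.Bijective Φ := by
    rw [Fintype.bijective_iff_injective_and_card]
    refine ⟨hinj, ?_⟩
    simp [Fintype.card_perm, Nat.factorial_succ]
  rw [← hbij.sum_comp, Fintype.sum_prod_type]
  refine sum_congr rfl fun j _ => sum_congr rfl fun τ _ => ?_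
  congr 1
  funext k
  refine Fin.lastCases ?_ (fun k => ?_) k
  · simp [hlast]
  · simp [hcast]

theorem image_comp_succAbove {ι : Type*} [DecidableEq ι] {n : ℕ} {e : Fin (n + 1) → ι}
    (he : Function.Injective e) (j : Fin (n + 1)) :
    univ.image (e ∘ j.succAbove) = (univ.image e).erase (e j) := by
  ext x
  simp only [mem_erase, mem_image, mem_univ, true_and, Function.comp]
  constructor
  · rintro ⟨i, rfl⟩
    exact ⟨fun h => Fin.succAbove_ne j i (he h), _, rfl⟩
  · rintro ⟨h, k, rfl⟩
    obtain ⟨i, rfl⟩ := Fin.exists_succAbove_eq (fun hk => h (by rw [hk]) : k ≠ j)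
    exact ⟨i, rfl⟩

/-! ### From sums over permutations to sums over subsets. -/

section Symmetrization

variable {K ι : Type*} [Field K]

/-- The product of `f` over the first `r` entries of `v`, of `g` over the remaining ones, and of
`φ` over the ordered pairs of entries. -/
def orderedWeight (f g : ι → K) (φ : ι → ι → K) (r : ℕ) {n : ℕ} (v : Fin n → ι) : K :=
  (∏ k, if k.val < r then f (v k) else g (v k)) *
    ∏ i, ∏ j, if i < j then φ (v i) (v j) else 1

theorem orderedWeight_snoc (f g : ι → K) (φ : ι → ι → K) {r n : ℕ} (hr : r ≤ n)
    (v : Fin n → ι) (x : ι) :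
    orderedWeight f g φ r (Fin.snoc (α := fun _ => ι) v x) =
      g x * (∏ i, φ (v i) x) * orderedWeight f g φ r v := by
  have h (i : Fin n) : ¬ Fin.last n < i.castSucc := not_lt.2 (Fin.le_last _)
  simp only [orderedWeight, Fin.prod_univ_castSucc, Fin.snoc_castSucc, Fin.snoc_last,
    Fin.val_castSucc, Fin.val_last, hr.not_gt, if_false, Fin.castSucc_lt_castSucc_iff,
    Fin.castSucc_lt_last, if_true, h, lt_irrefl, prod_const_one, mul_one, prod_mul_distrib]
  ring

theorem sum_orderedWeight_succ [DecidableEq ι] (f g : ι → K) (φ : ι → ι → K) {r n : ℕ}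
    (hr : r ≤ n) {e : Fin (n + 1) → ι} (he : Function.Injective e) :
    ∑ σ : Equiv.Perm (Fin (n + 1)), orderedWeight f g φ r (e ∘ σ) =
      ∑ j, g (e j) * (∏ i ∈ (univ.image e).erase (e j), φ i (e j)) *
        ∑ τ : Equiv.Perm (Fin n), orderedWeight f g φ r ((e ∘ j.succAbove) ∘ τ) := by
  rw [sum_perm_succ]
  refine sum_congr rfl fun j _ => ?_
  rw [mul_sum]
  refine sum_congr rfl fun τ _ => ?_
  rw [orderedWeight_snoc _ _ _ hr]
  congr 2
  rw [← image_comp_succAbove he, prod_image (he.comp Fin.succAbove_right_injective).injOn]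
  exact Equiv.prod_comp τ fun i => φ (e (j.succAbove i)) (e j)

/-- The weight of a subset `I` of `S`: elements of `I` come first. -/
def subsetWeight [DecidableEq ι] (f g : ι → K) (φ : ι → ι → K) (S I : Finset ι) : K :=
  (∏ i ∈ I, f i) * (∏ j ∈ S \ I, g j) * ∏ i ∈ I, ∏ j ∈ S \ I, φ i j

/-- Double counting of pairs `(j, I)` with `j ∈ S \ I`: for fixed `I`, the factors depending on `j`
are those of `hφ` for `T = S \ I`. -/
theorem sum_erase_subsetWeight [DecidableEq ι] (f g : ι → K) (φ : ι → ι → K) (N : ℕ → K)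
    (hφ : ∀ T : Finset ι, ∑ j ∈ T, ∏ l ∈ T.erase j, φ l j = N #T) (r : ℕ) (S : Finset ι) :
    ∑ j ∈ S, g j * (∏ i ∈ S.erase j, φ i j) *
        ∑ I ∈ (S.erase j).powersetCard r, subsetWeight f g φ (S.erase j) I =
      N (#S - r) * ∑ I ∈ S.powersetCard r, subsetWeight f g φ S I := by
  simp only [mul_sum]
  rw [sum_comm' (t' := S.powersetCard r) (s' := fun I => S \ I)]
  · refine sum_congr rfl fun I hI => ?_
    obtain ⟨hIS, rfl⟩ := mem_powersetCard.1 hI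
    rw [← card_sdiff_of_subset hIS, ← hφ, sum_mul]
    refine sum_congr rfl fun j hj => ?_
    have hjS := (mem_sdiff.1 hj).1
    have hjI := (mem_sdiff.1 hj).2
    have h1 : S.erase j \ I = (S \ I).erase j := by ext; simp; tauto
    have h2 : S.erase j = I ∪ (S \ I).erase j := by
      ext x
      simp only [mem_erase, mem_union, mem_sdiff]
      constructor
      · tauto
      · rintro (h | h)
        · exact ⟨fun hx => hjI (hx ▸ h), hIS h⟩
        · tauto
    have h3 : Disjoint I ((S \ I).erase j) := by
      rw [disjoint_left]
      simp +contextual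
    rw [subsetWeight, subsetWeight, h1, h2, prod_union h3, ← mul_prod_erase _ g hj]
    have h4 : ∏ i ∈ I, ∏ l ∈ S \ I, φ i l =
        (∏ i ∈ I, φ i j) * ∏ i ∈ I, ∏ l ∈ (S \ I).erase j, φ i l := by
      rw [← prod_mul_distrib]
      exact prod_congr rfl fun i _ => (mul_prod_erase _ _ hj).symm
    rw [h4]
    ring
  · intro j I
    simp only [mem_powersetCard, mem_sdiff, subset_erase]
    tauto

theorem sum_orderedWeight_one [DecidableEq ι] (φ : ι → ι → K) (N : ℕ → K)
    (hφ : ∀ T : Finset ι, ∑ j ∈ T, ∏ l ∈ T.erase j, φ l j = N #T) {n : ℕ} {e : Fin n → ι}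
    (he : Function.Injective e) :
    ∑ σ : Equiv.Perm (Fin n), orderedWeight 1 1 φ 0 (e ∘ σ) = ∏ k ∈ Icc 1 n, N k := by
  induction n with
  | zero => simp [orderedWeight]
  | succ n ih =>
    rw [sum_orderedWeight_succ _ _ _ (Nat.zero_le _) he, prod_Icc_succ_top (by omega), mul_comm]
    simp only [fun j : Fin (n + 1) => ih (he.comp (Fin.succAbove_right_injective (p := j))),
      ← sum_mul, Pi.one_apply, one_mul]
    congr 1
    have := hφ (univ.image e)
    rw [sum_image (fun a _ b _ h => he h), card_image_of_injective _ he] at this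
    simpa using this

/-- Symmetrizing an ordered weight yields a sum over the subsets of size `r`. -/
theorem sum_orderedWeight [DecidableEq ι] (f g : ι → K) (φ : ι → ι → K) (N : ℕ → K)
    (hφ : ∀ T : Finset ι, ∑ j ∈ T, ∏ l ∈ T.erase j, φ l j = N #T) (r d n : ℕ) (hn : r + d = n)
    {e : Fin n → ι} (he : Function.Injective e) :
    ∑ σ : Equiv.Perm (Fin n), orderedWeight f g φ r (e ∘ σ) =
      (∏ k ∈ Icc 1 r, N k) * (∏ k ∈ Icc 1 d, N k) *
        ∑ I ∈ (univ.image e).powersetCard r, subsetWeight f g φ (univ.image e) I := by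
  -- With `r` fixed and `d > 0`, the entry split off is always one that carries `g`.
  induction d generalizing n with
  | zero =>
    obtain rfl : r = n := hn
    have hc : #(univ.image e) = r := by simp [card_image_of_injective _ he]
    have hp : (univ.image e).powersetCard r = {univ.image e} := by
      have := powersetCard_self (univ.image e)
      rwa [hc] at this
    rw [hp, sum_singleton, subsetWeight, prod_image he.injOn, ← sum_orderedWeight_one φ N hφ he]
    simp only [sdiff_self, bot_eq_empty, prod_empty, prod_const_one, mul_one, Icc_eq_empty_of_lt zero_lt_one,
      sum_mul]
    refine sum_congr rfl fun σ _ => ?_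
    simp only [orderedWeight, Fin.isLt, if_true, Pi.one_apply, ite_self, prod_const_one, one_mul]
    rw [mul_comm]
    congr 1
    exact Equiv.prod_comp σ fun k => f (e k)
  | succ d ih =>
    obtain rfl : r + d + 1 = n := hn
    rw [sum_orderedWeight_succ _ _ _ (Nat.le_add_right r d) he]
    have himg (j : Fin (r + d + 1)) :
        univ.image (e ∘ j.succAbove) = (univ.image e).erase (e j) :=
      image_comp_succAbove he j
    simp only [fun j : Fin (r + d + 1) =>
      ih (r + d) rfl (he.comp (Fin.succAbove_right_injective (p := j))), himg]
    have h := sum_erase_subsetWeight f g φ N hφ r (univ.image e)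
    rw [sum_image he.injOn, card_image_of_injective _ he, card_univ, Fintype.card_fin,
      show r + d + 1 - r = d + 1 by omega] at h
    rw [prod_Icc_succ_top (by omega : 1 ≤ d + 1), ← mul_assoc, mul_assoc _ (N (d + 1)), ← h,
      mul_sum]
    exact sum_congr rfl fun j _ => by ring

end Symmetrization

/-! ### The t-integer identity, by Lagrange interpolation. -/

section Interpolation

variable {K ι : Type*} [Field K]

-- Interpolate `P` at the points `z j`, `j ∈ T`, and evaluate at `0`. At each node the second
-- product in `P` vanishes.
open Polynomial in
theorem sum_prod_erase_div [DecidableEq ι] {z : ι → K} (hz : Function.Injective z)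
    (hz0 : ∀ i, z i ≠ 0) {t : K} (ht : 1 - t ≠ 0) (T : Finset ι) :
    ∑ j ∈ T, ∏ l ∈ T.erase j, (z l - t * z j) / (z l - z j) = (1 - t ^ #T) / (1 - t) := by
  -- The factor `t ^ #T` makes the coefficients of degree `#T` cancel, so that `#T` nodes determine
  -- `P`.
  set P : K[X] := ∏ l ∈ T, (C (z l) - C t * X) - C (t ^ #T) * ∏ l ∈ T, (C (z l) - X) with hP
  have hdeg : P.degree < #T := by
    have h1 : ∀ l ∈ T, (C (z l) - C t * X).natDegree ≤ 1 := fun l _ => by compute_degree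
    have h2 : ∀ l ∈ T, (C (z l) - X).natDegree ≤ 1 := fun l _ => by compute_degree
    have hn : P.natDegree ≤ #T := by
      refine (natDegree_sub_le _ _).trans (max_le ?_ ((natDegree_C_mul_le _ _).trans ?_))
      · exact (natDegree_prod_le _ _).trans ((sum_le_card_nsmul _ _ _ h1).trans_eq (by simp))
      · exact (natDegree_prod_le _ _).trans ((sum_le_card_nsmul _ _ _ h2).trans_eq (by simp))
    have hc : P.coeff #T = 0 := by
      have e1 := coeff_prod_of_natDegree_le _ _ 1 h1
      have e2 := coeff_prod_of_natDegree_le _ _ 1 h2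
      rw [mul_one] at e1 e2
      have e3 (l : ι) : (C (z l) - C t * X).coeff 1 = -t := by simp [coeff_C]
      have e4 (l : ι) : (C (z l) - X).coeff 1 = -1 := by simp
      rw [hP, coeff_sub, coeff_C_mul, e1, e2, prod_congr rfl fun l _ => e3 l,
        prod_congr rfl fun l _ => e4 l, prod_const, prod_const, neg_pow t]
      ring
    refine lt_of_le_of_ne (natDegree_le_iff_degree_le.1 hn) fun h => ?_
    exact coeff_ne_zero_of_eq_degree h hc
  have heval := congrArg (Polynomial.eval 0) (Lagrange.eq_interpolate hz.injOn hdeg)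
  have hP0 : P.eval 0 = (1 - t ^ #T) * ∏ l ∈ T, z l := by
    simp [hP, eval_prod]; ring
  have hPz : ∀ j ∈ T, P.eval (z j) = (1 - t) * z j * ∏ l ∈ T.erase j, (z l - t * z j) := by
    intro j hj
    have : ∏ l ∈ T, (z l - z j) = 0 := prod_eq_zero hj (sub_self _)
    simp only [hP, eval_sub, eval_mul, eval_prod, eval_C, eval_X, this, mul_zero, sub_zero]
    rw [← mul_prod_erase _ _ hj]
    ring
  rw [hP0, Lagrange.interpolate_apply, eval_finsetSum] at heval
  have hprod : ∏ l ∈ T, z l ≠ 0 := prod_ne_zero_iff.2 fun i _ => hz0 i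
  rw [eq_div_iff ht, ← mul_left_inj' hprod, heval, sum_mul, sum_mul]
  refine sum_congr rfl fun j hj => ?_
  rw [eval_mul, eval_C, hPz j hj, Lagrange.basis, eval_prod, ← mul_prod_erase _ _ hj]
  have : ∏ l ∈ T.erase j, eval 0 (Lagrange.basisDivisor (z j) (z l)) =
      ∏ l ∈ T.erase j, z l / (z l - z j) := by
    refine prod_congr rfl fun l _ => ?_
    simp only [Lagrange.basisDivisor, eval_mul, eval_C, eval_sub, eval_X]
    rw [← neg_sub (z l) (z j), inv_neg]
    ring
  rw [this, prod_div_distrib, prod_div_distrib]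
  ring

end Interpolation

/-! ### Vandermonde determinants with scaled rows. -/

section Vandermonde

variable {K : Type*} [Field K]

theorem prod_pairs_mul_swap {n : ℕ} (a : Fin n → Fin n → K) (ha : ∀ i, a i i = 1) :
    ∏ i, ∏ j ∈ Ioi i, (a i j * a j i) = ∏ i, ∏ j, a i j := by
  have h1 : ∏ i, ∏ j ∈ Ioi i, a j i = ∏ i, ∏ j ∈ Iio i, a i j :=
    prod_comm' (by simp)
  simp only [prod_mul_distrib]
  rw [h1, ← prod_mul_distrib]
  refine prod_congr rfl fun i _ => ?_
  have h2 : (univ : Finset (Fin n)) = insert i (Ioi i ∪ Iio i) := by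
    ext x
    simp only [mem_univ, mem_insert, mem_union, mem_Ioi, mem_Iio, true_iff]
    rcases lt_trichotomy x i with h | h | h <;> tauto
  rw [h2, prod_insert (by simp), ha, one_mul, prod_union]
  rw [disjoint_left]
  simp +contextual [le_of_lt]

theorem prod_pairs_ite {n : ℕ} (p : Fin n → Prop) [DecidablePred p] (t : K) :
    ∏ i, ∏ j ∈ Ioi i, (if p i ∧ p j then t else 1) = t ^ (#{i | p i}).choose 2 := by
  induction n with
  | zero => simp
  | succ n ih =>
    rw [Fin.prod_univ_succ, Fin.prod_Ioi_zero]
    simp only [Fin.prod_Ioi_succ]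
    rw [ih fun i => p i.succ, Fin.card_filter_univ_succ]
    by_cases h : p 0
    · simp only [h, true_and, if_true]
      rw [prod_ite, prod_const, prod_const_one, mul_one, ← pow_add, Nat.choose_succ_succ' _ 1,
        Nat.choose_one_right]
    · simp only [h, false_and, if_false, prod_const_one, one_mul]

/-- Scaling the variables outside `I` by `t` multiplies the Vandermonde determinant by a power
of `t` and a product over the pairs separated by `I`. -/
theorem det_vandermonde_scale {n : ℕ} {z : Fin n → K} (hz : Function.Injective z) (t : K)
    (I : Finset (Fin n)) :
    (Matrix.vandermonde fun i => if i ∈ I then z i else t * z i).det =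
      t ^ (#Iᶜ).choose 2 * (∏ i ∈ I, ∏ j ∈ Iᶜ, (z i - t * z j) / (z i - z j)) *
        (Matrix.vandermonde z).det := by
  let a : Fin n → Fin n → K := fun i j =>
    if i ∈ I ∧ j ∈ Iᶜ then (z i - t * z j) / (z i - z j) else 1
  have ha : ∏ i ∈ I, ∏ j ∈ Iᶜ, (z i - t * z j) / (z i - z j) = ∏ i, ∏ j, a i j := by
    rw [← prod_subset (subset_univ I)]
    · refine prod_congr rfl fun i hi => ?_
      rw [← prod_subset (subset_univ Iᶜ)]
      · exact prod_congr rfl fun j hj => (if_pos ⟨hi, hj⟩).symm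
      · exact fun j _ hj => if_neg fun h => hj h.2
    · exact fun i _ hi => prod_eq_one fun j _ => if_neg fun h => hi h.1
  have hI : Iᶜ = ({i | i ∈ Iᶜ} : Finset (Fin n)) := by ext; simp
  rw [ha, ← prod_pairs_mul_swap a (fun i => if_neg (by simp)),
    show (#Iᶜ).choose 2 = (#{i | i ∈ Iᶜ}).choose 2 by rw [← hI], ← prod_pairs_ite,
    Matrix.det_vandermonde, Matrix.det_vandermonde, ← prod_mul_distrib, ← prod_mul_distrib]
  refine prod_congr rfl fun i _ => ?_
  rw [← prod_mul_distrib, ← prod_mul_distrib]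
  refine prod_congr rfl fun j hj => ?_
  have hij : i ≠ j := (mem_Ioi.1 hj).ne
  have h1 : z i - z j ≠ 0 := sub_ne_zero.2 (hz.ne hij)
  have h2 : z j - z i ≠ 0 := sub_ne_zero.2 (hz.ne hij.symm)
  -- The pair's Vandermonde factor is unchanged inside `I`, gains `t` outside `I`, and gains the
  -- quotient in `a` when `I` separates the pair.
  by_cases hi : i ∈ I <;> by_cases hj : j ∈ I <;> simp [a, hi, hj]
    <;> field_simp <;> ring

/-- Multilinearity of the Vandermonde determinant in its rows. -/
theorem det_add_vandermonde {n : ℕ} (a b x y : Fin n → K) :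
    (Matrix.of fun i k : Fin n => a i * x i ^ k.val + b i * y i ^ k.val).det =
      ∑ I : Finset (Fin n), (∏ i ∈ I, a i) * (∏ j ∈ Iᶜ, b j) *
        (Matrix.vandermonde fun i => if i ∈ I then x i else y i).det := by
  have h := (Matrix.detRowAlternating (R := K) (n := Fin n)).toMultilinearMap.map_add_univ
    (fun i k => a i * x i ^ k.val) (fun i k => b i * y i ^ k.val)
  have h0 : (Matrix.of fun i k : Fin n => a i * x i ^ k.val + b i * y i ^ k.val).det =
    Matrix.detRowAlternating.toMultilinearMap
      ((fun i k => a i * x i ^ k.val) + (fun i k => b i * y i ^ k.val)) := rfl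
  rw [h0, h]
  refine sum_congr rfl fun I _ => ?_
  have h1 : I.piecewise (fun i (k : Fin n) => a i * x i ^ k.val) (fun i k => b i * y i ^ k.val) =
      fun i k => (if i ∈ I then a i else b i) *
        (Matrix.vandermonde fun i => if i ∈ I then x i else y i) i k := by
    funext i k
    by_cases hi : i ∈ I <;> simp [hi, Matrix.vandermonde_apply]
  rw [h1]
  have h2 : ∏ i, (if i ∈ I then a i else b i) = (∏ i ∈ I, a i) * ∏ j ∈ Iᶜ, b j := by
    rw [← prod_mul_prod_compl I]
    congr 1
    · exact prod_congr rfl fun i hi => if_pos hi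
    · exact prod_congr rfl fun i hi => if_neg (mem_compl.1 hi)
  rw [← h2]
  exact Matrix.det_mul_column _ _

/-- The columns of this matrix are values of `n + 1` polynomials in the span of
`X, X ^ 2, …, X ^ n`. -/
theorem det_eq_zero_of_scaling {n : ℕ} (z : Fin (n + 1) → K) (c t w : K) (hc : c ^ 2 = t ^ n) :
    (Matrix.of fun i k : Fin (n + 1) =>
      c * (w - c * z i) * z i ^ k.val + (z i - c * w) * (t * z i) ^ k.val).det = 0 := by
  -- Column `k` holds the coefficients of the polynomial giving the `k`-th entries. Its constant
  -- term vanishes, even for `k = 0`, where `1 - t ^ 0 = 0`.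
  let B : Matrix (Fin (n + 1)) (Fin (n + 1)) K := Matrix.of fun l k =>
    (if l = k then c * w * (1 - t ^ k.val) else 0) +
      if l.val = k.val + 1 then t ^ k.val - c ^ 2 else 0
  have h : (Matrix.of fun i k : Fin (n + 1) =>
      c * (w - c * z i) * z i ^ k.val + (z i - c * w) * (t * z i) ^ k.val) =
      Matrix.vandermonde z * B := by
    ext i k
    simp only [Matrix.of_apply, Matrix.mul_apply, Matrix.vandermonde_apply, B, mul_add,
      sum_add_distrib, mul_ite, mul_zero, sum_ite_eq', mem_univ, if_true]
    have h1 : (∑ l : Fin (n + 1), if l.val = k.val + 1 then z i ^ l.val * (t ^ k.val - c ^ 2)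
        else 0) = z i ^ (k.val + 1) * (t ^ k.val - c ^ 2) := by
      rcases (Nat.lt_succ_iff.1 k.isLt).lt_or_eq with hk | hk
      · rw [sum_eq_single (⟨k.val + 1, by omega⟩ : Fin (n + 1))]
        · simp
        · intro l _ hl
          exact if_neg fun h => hl (Fin.ext h)
        · simp
      -- For `k = n` the power `z ^ (n + 1)` has no row in `B`; `hc` makes its coefficient zero.
      · rw [hk, hc, sub_self, mul_zero]
        exact sum_eq_zero fun l _ => by simp
    rw [h1]
    ring
  rw [h, Matrix.det_mul, Matrix.det_eq_zero_of_row_eq_zero (A := B) 0, mul_zero]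
  intro k
  simp only [B, Matrix.of_apply]
  by_cases hk : (0 : Fin (n + 1)) = k
  · subst hk; simp
  · simp [hk]

end Vandermonde

/-! ### The identity for distinct nonzero elements of a field. -/

section SerreSum

variable {K : Type*} [Field K]

theorem qFactorial_ne_zero {q : K} (hq0 : q ≠ 0) (hq : ∀ n : ℕ, 0 < n → q ^ n ≠ 1) (n : ℕ) :
    qFactorial q n ≠ 0 := by
  have h (k : ℕ) (hk : 0 < k) : q ^ k - q⁻¹ ^ k ≠ 0 := fun h0 => by
    rw [inv_pow, sub_eq_zero, ← mul_eq_one_iff_eq_inv₀ (pow_ne_zero k hq0), ← pow_add] at h0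
    exact hq _ (by omega) h0
  refine prod_ne_zero_iff.2 fun k hk => div_ne_zero (h k (mem_Icc.1 hk).1) ?_
  simpa using h 1 one_pos

/-- Each factor is `q ^ (k - 1) * [k]`, and the exponents add up to `n.choose 2`. -/
theorem prod_geom_eq_qFactorial {q : K} (hq0 : q ≠ 0) (hq2 : q ^ 2 ≠ 1) (n : ℕ) :
    ∏ k ∈ Icc 1 n, (1 - (q ^ 2) ^ k) / (1 - q ^ 2) = q ^ n.choose 2 * qFactorial q n := by
  induction n with
  | zero => simp [qFactorial]
  | succ n ih =>
    rw [qFactorial, prod_Icc_succ_top (by omega), prod_Icc_succ_top (by omega), ih,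
      ← qFactorial, Nat.choose_succ_succ' n 1, Nat.choose_one_right]
    have h1 : 1 - q ^ 2 ≠ 0 := sub_ne_zero.2 hq2.symm
    have h2 : (1 - (q ^ 2) ^ (n + 1)) / (1 - q ^ 2) = q ^ n * qNumber q (n + 1) := by
      have h3 : q - q⁻¹ ≠ 0 := fun h => h1 (by
        have : q * (q - q⁻¹) = q ^ 2 - 1 := by field_simp
        rw [h, mul_zero] at this
        linear_combination this)
      rw [qNumber, mul_div_assoc', div_eq_div_iff h1 h3, inv_pow]
      field_simp
      ring
    rw [h2]
    ring

/-- Balances the powers of `q`: two t-factorials and the normalization on the left, `t ^ d.choose 2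
* c ^ r` on the right. The truncated subtraction matters only when it is multiplied by `r = 0`. -/
theorem choose_two_add_choose_two (r d : ℕ) :
    r.choose 2 + d.choose 2 + (r + d).choose 2 = 2 * d.choose 2 + (r + d - 1) * r := by
  have h1 : (r + d).choose 2 = r.choose 2 + d.choose 2 + r * d := by
    induction d with
    | zero => simp
    | succ d ih =>
      rw [← add_assoc, Nat.choose_succ_succ' _ 1, Nat.choose_succ_succ' _ 1, ih]
      simp only [Nat.choose_one_right]
      ring
  have h2 : 2 * r.choose 2 + r * d = (r + d - 1) * r := by
    cases r with
    | zero => simp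
    | succ r =>
      rw [Nat.choose_two_right, Nat.mul_div_cancel' (Nat.even_mul_pred_self _).two_dvd,
        show r + 1 + d - 1 = r + d by omega, Nat.add_sub_cancel]
      ring
  omega

/-- The Serre identity in any field, for distinct nonzero elements `z i`. -/
theorem sum_qBinomial_mul_orderedWeight {q : K} (hq0 : q ≠ 0)
    (hq : ∀ n : ℕ, 0 < n → q ^ n ≠ 1) {m : ℕ} (hm : 1 ≤ m) (w : K) {z : Fin m → K}
    (hz : Function.Injective z) (hz0 : ∀ i, z i ≠ 0) :
    ∑ σ : Equiv.Perm (Fin m), ∑ r ∈ range (m + 1), qBinomial q m r *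
      orderedWeight (fun i => w - q ^ (m - 1) * z i) (fun i => z i - q ^ (m - 1) * w)
        (fun i j => (z i - q ^ 2 * z j) / (z i - z j)) r σ = 0 := by
  set c := q ^ (m - 1) with hc
  set f : Fin m → K := fun i => w - c * z i
  set g : Fin m → K := fun i => z i - c * w
  set φ : Fin m → Fin m → K := fun i j => (z i - q ^ 2 * z j) / (z i - z j) with hφ
  have hq2 : q ^ 2 ≠ 1 := hq 2 two_pos
  have hV : (Matrix.vandermonde z).det ≠ 0 := Matrix.det_vandermonde_ne_zero_iff.2 hz
  have hqV : q ^ m.choose 2 * (Matrix.vandermonde z).det ≠ 0 :=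
    mul_ne_zero (pow_ne_zero _ hq0) hV
  -- Each `r` contributes the part of the determinant expansion with `#I = r`.
  have key (r : ℕ) (hr : r ∈ range (m + 1)) :
      q ^ m.choose 2 * (Matrix.vandermonde z).det *
        (qBinomial q m r * ∑ σ : Equiv.Perm (Fin m), orderedWeight f g φ r σ) =
      qFactorial q m * ∑ I ∈ univ.powersetCard r, (∏ i ∈ I, c * f i) * (∏ j ∈ Iᶜ, g j) *
        (Matrix.vandermonde fun i => if i ∈ I then z i else q ^ 2 * z i).det := by
    obtain ⟨d, rfl⟩ := Nat.exists_eq_add_of_le (Nat.lt_succ_iff.1 (mem_range.1 hr))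
    have h := sum_orderedWeight f g φ (fun k => (1 - (q ^ 2) ^ k) / (1 - q ^ 2))
      (sum_prod_erase_div hz hz0 (sub_ne_zero.2 hq2.symm)) r d (r + d) rfl
      Function.injective_id
    simp only [Function.id_comp, image_id, prod_geom_eq_qFactorial hq0 hq2] at h
    rw [h, qBinomial, Nat.add_sub_cancel_left]
    have h1 := qFactorial_ne_zero hq0 hq r
    have h2 := qFactorial_ne_zero hq0 hq d
    simp only [mul_sum]
    refine sum_congr rfl fun I hI => ?_
    have hIr : #I = r := (mem_powersetCard.1 hI).2
    have hId : #Iᶜ = d := by rw [card_compl, hIr, Fintype.card_fin, Nat.add_sub_cancel_left]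
    have hpow : q ^ r.choose 2 * q ^ d.choose 2 * q ^ (r + d).choose 2 =
        (q ^ 2) ^ d.choose 2 * c ^ r := by
      rw [← pow_add, ← pow_add, choose_two_add_choose_two, pow_add, pow_mul, pow_mul]
    rw [det_vandermonde_scale hz, hId, prod_mul_distrib, prod_const, hIr, subsetWeight,
      ← compl_eq_univ_sdiff]
    calc _ = (q ^ r.choose 2 * q ^ d.choose 2 * q ^ (r + d).choose 2) * qFactorial q (r + d) *
          (Matrix.vandermonde z).det *
          ((∏ i ∈ I, f i) * (∏ j ∈ Iᶜ, g j) * ∏ i ∈ I, ∏ j ∈ Iᶜ, φ i j) := by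
          field_simp
      _ = _ := by rw [hpow]; ring
  refine (mul_eq_zero.1 ?_).resolve_left hqV
  rw [sum_comm]
  simp only [← mul_sum]
  rw [mul_sum, sum_congr rfl key, ← mul_sum]
  have hsum := sum_powerset (univ : Finset (Fin m)) fun I =>
    (∏ i ∈ I, c * f i) * (∏ j ∈ Iᶜ, g j) *
      (Matrix.vandermonde fun i => if i ∈ I then z i else q ^ 2 * z i).det
  rw [card_univ, Fintype.card_fin, powerset_univ] at hsum
  rw [← hsum, ← det_add_vandermonde]
  obtain ⟨n, rfl⟩ := Nat.exists_eq_add_of_le' hm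
  rw [det_eq_zero_of_scaling z c (q ^ 2) w, mul_zero]
  rw [hc, Nat.add_sub_cancel, ← pow_mul, ← pow_mul, mul_comm]

end SerreSum

/-! ### Specialization to the variables of the rational function field. -/

section RationalFunctions

variable {F : Type*} [Field F]

/-- The constants of the field of rational functions. -/
noncomputable def scalarHom (F : Type*) [Field F] (m : ℕ) : F →+* RatFunc F m :=
  (algebraMap (MvPolynomial (Option (Fin m)) F) (RatFunc F m)).comp MvPolynomial.C

theorem scalar_eq_scalarHom (m : ℕ) (c : F) : scalar m c = scalarHom F m c := rfl

theorem zVar_injective (m : ℕ) : Function.Injective (zVar F : Fin m → RatFunc F m) :=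
  (IsFractionRing.injective _ _).comp
    ((MvPolynomial.X_injective).comp (Option.some_injective _))

theorem zVar_ne_zero {m : ℕ} (i : Fin m) : zVar F i ≠ 0 :=
  (map_ne_zero_iff _ (IsFractionRing.injective _ _)).2 (MvPolynomial.X_ne_zero _)

theorem map_qBinomial {K : Type*} [Field K] (φ : F →+* K) (q : F) (m r : ℕ) :
    φ (qBinomial q m r) = qBinomial (φ q) m r := by
  simp [qBinomial, qFactorial, qNumber]

theorem permute_term (q : F) {m : ℕ} (r : ℕ) (σ : Equiv.Perm (Fin m)) :
    permute σ (term q m r) = qBinomial (scalarHom F m q) m r *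
      orderedWeight (fun i => wVar F m - scalarHom F m q ^ (m - 1) * zVar F i)
        (fun i => zVar F i - scalarHom F m q ^ (m - 1) * wVar F m)
        (fun i j => (zVar F i - scalarHom F m q ^ 2 * zVar F j) / (zVar F i - zVar F j)) r σ := by
  simp only [term, orderedWeight, map_mul, map_prod, map_sub, map_div₀, permute_zVar,
    permute_wVar, permute_scalar]
  simp only [scalar_eq_scalarHom, map_qBinomial, map_pow]
  rw [prod_ite, ← Fintype.prod_prod_type', ← prod_filter]
  simp only [not_lt, mul_assoc]

end RationalFunctions

end SerreIdentity

theorem mainTheorem4 {F : Type*} [Field F] (q : F) (hq0 : q ≠ 0)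
    (hq : ∀ n : ℕ, 0 < n → q ^ n ≠ 1) (m : ℕ) (hm : 1 ≤ m) :
    ∑ σ : Equiv.Perm (Fin m), ∑ r ∈ Finset.range (m + 1),
      SerreIdentity.permute σ (SerreIdentity.term q m r) = 0 := by
  simp only [SerreIdentity.permute_term]
  refine SerreIdentity.sum_qBinomial_mul_orderedWeight ?_ ?_ hm _
    (SerreIdentity.zVar_injective m) SerreIdentity.zVar_ne_zero
  · exact (map_ne_zero _).2 hq0
  · intro n hn h
    rw [← map_pow] at h
    exact hq n hn ((map_eq_one_iff _ (SerreIdentity.scalarHom F m).injective).1 h)
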